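/- **Setting.** Let $S$ be a set of $n \ge 2$ points in the plane, each coloured with one of $k \ge 2$ colours. A *monochromatic island* is a set $I \subseteq S$ of points of a single colour with $\mathrm{CH}(I) \cap S = I$, where $\mathrm{CH}$ denotes the convex hull. An *island partition* of $S$ is a partition of $S$ into non-empty monochromatic islands whose convex hulls are pairwise disjoint; $\mathrm{Opt}_{\mathrm P}$ denotes the minimum cardinality of an island partition of $S$. Only lines that contain no point of $S$ are considered. A finite set $L$ of such lines *separates* $S$ if, for every face of the arrangement of $L$ (every connected component of the complement of $\bigcup L$), the points of $S$ in that face all have the same colour. *Line-greedy* starts with $L = \emptyset$ and, as long as $L$ does not separate $S$, adds to $L$ a line that separates (has strictly on opposite sides) the maximum number of those pairs of differently coloured points of $S$ that are not separated by any line already in $L$; ties are broken arbitrarily. When $L$ separates $S$, line-greedy stops, and the partition it *induces* consists of the sets $S \cap F$, over all faces $F$ of the arrangement of the returned set $L$ that contain points of $S$. **Lemma.** Line-greedy induces an $O(\mathrm{Opt}_{\mathrm P} \log^2 n)$-approximation to the minimum-cardinality island partition. That is, there is an absolute constant $C > 0$ such that for all $k$, $n$ and $S$ as above, line-greedy can always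 continue until it stops and always stops after finitely many steps, and, however ties are broken, the partition it induces is an island partition of $S$ with at most $$\bigl(C \cdot \mathrm{Opt}_{\mathrm P} \cdot \log^2 n\bigr) \cdot \mathrm{Opt}_{\mathrm P}$$ islands. -/

import Mathlib

/-- The Euclidean plane. -/
abbrev Plane : Type := EuclideanSpace ℝ (Fin 2)

/-- All points of `I` have the same colour. -/
def IsMonochromatic {k : ℕ} (c : Plane → Fin k) (I : Set Plane) : Prop :=
  ∀ p ∈ I, ∀ q ∈ I, c p = c q

/-- `I` is an island of the point set `S`: the convex hull of `I` contains no further point of `S`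
(this includes `I ⊆ S`). -/
def IsIsland (S I : Finset Plane) : Prop :=
  convexHull ℝ (I : Set Plane) ∩ (S : Set Plane) = (I : Set Plane)

/-- `P` is a partition of the coloured point set `S` into monochromatic islands whose convex
hulls are pairwise disjoint. -/
structure IsIslandPartition {k : ℕ} (S : Finset Plane) (c : Plane → Fin k)
    (P : Finset (Finset Plane)) : Prop where
  nonempty : ∀ I ∈ P, I.Nonempty
  island : ∀ I ∈ P, IsIsland S I
  monochromatic : ∀ I ∈ P, IsMonochromatic c (I : Set Plane)
  covers : ∀ p ∈ S, ∃ I ∈ P, p ∈ I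
  disjoint_hulls : ∀ I ∈ P, ∀ J ∈ P, I ≠ J →
    Disjoint (convexHull ℝ (I : Set Plane)) (convexHull ℝ (J : Set Plane))

/-- The minimum cardinality of an island partition of `S`. -/
noncomputable def optPartition {k : ℕ} (S : Finset Plane) (c : Plane → Fin k) : ℕ :=
  sInf {m : ℕ | ∃ P : Finset (Finset Plane), IsIslandPartition S c P ∧ P.card = m}

open Classical in
/-- The singletons form an island partition. -/
theorem isIslandPartition_singletons {k : ℕ} (S : Finset Plane) (c : Plane → Fin k) :
    IsIslandPartition S c (S.image fun p => {p}) where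
  nonempty := by
    intro I hI
    obtain ⟨p, -, rfl⟩ := Finset.mem_image.1 hI
    exact Finset.singleton_nonempty p
  island := by
    intro I hI
    obtain ⟨p, hp, rfl⟩ := Finset.mem_image.1 hI
    simp [IsIsland, hp]
  monochromatic := by
    intro I hI
    obtain ⟨p, -, rfl⟩ := Finset.mem_image.1 hI
    simp [IsMonochromatic]
  covers := fun p hp => ⟨{p}, Finset.mem_image_of_mem _ hp, Finset.mem_singleton_self p⟩
  disjoint_hulls := by
    intro I hI J hJ hne
    obtain ⟨p, -, rfl⟩ := Finset.mem_image.1 hI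
    obtain ⟨q, -, rfl⟩ := Finset.mem_image.1 hJ
    have hpq : p ≠ q := fun h => hne (by rw [h])
    simpa using hpq

/-- The minimum in the definition of `optPartition` is attained. -/
theorem exists_card_eq_optPartition {k : ℕ} (S : Finset Plane) (c : Plane → Fin k) :
    ∃ P : Finset (Finset Plane), IsIslandPartition S c P ∧ P.card = optPartition S c :=
  Nat.sInf_mem (s := {m : ℕ | ∃ P : Finset (Finset Plane), IsIslandPartition S c P ∧ P.card = m})
    ⟨_, _, isIslandPartition_singletons S c, rfl⟩

/-- A candidate separating line for `S`: a line in the plane that passes through no point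
of `S`. -/
def IsCandidateLine (S : Finset Plane) (l : AffineSubspace ℝ Plane) : Prop :=
  Module.finrank ℝ l.direction = 1 ∧ ∀ p ∈ S, p ∉ l

/-- `F` is a (two-dimensional, open) face of the arrangement of the lines in `L`, that is, a
connected component of the complement of their union. -/
def IsFace (L : List (AffineSubspace ℝ Plane)) (F : Set Plane) : Prop :=
  ∃ x ∈ (⋃ l ∈ L, (l : Set Plane))ᶜ, F = connectedComponentIn (⋃ l ∈ L, (l : Set Plane))ᶜ x

/-- The lines in `L` separate the coloured points: they avoid the points, and each face of
their arrangement is monochromatic. -/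
def Separates {k : ℕ} (S : Finset Plane) (c : Plane → Fin k)
    (L : List (AffineSubspace ℝ Plane)) : Prop :=
  (∀ l ∈ L, IsCandidateLine S l) ∧ ∀ F, IsFace L F → IsMonochromatic c ((S : Set Plane) ∩ F)

open Classical in
/-- The number of pairs of points of `S` of different colours that are separated by the line `l`
(lie strictly on opposite sides of it) and not by any line in `L`. The pairs are ordered, so each
unordered pair is counted exactly twice. -/
noncomputable def gain {k : ℕ} (S : Finset Plane) (c : Plane → Fin k)
    (L : List (AffineSubspace ℝ Plane)) (l : AffineSubspace ℝ Plane) : ℕ :=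
  ((S ×ˢ S).filter fun pq => c pq.1 ≠ c pq.2 ∧ (∀ l' ∈ L, ¬ l'.SOppSide pq.1 pq.2) ∧
    l.SOppSide pq.1 pq.2).card

/-- `L` lists, latest first, the lines picked during some number of steps of line-greedy: as long
as the lines picked so far do not separate the colours, a candidate line is picked that separates
the largest number of not yet separated pairs of points of different colours. Ties are broken
arbitrarily. -/
inductive IsLineGreedyRun {k : ℕ} (S : Finset Plane) (c : Plane → Fin k) :
    List (AffineSubspace ℝ Plane) → Prop
  | nil : IsLineGreedyRun S c []
  | cons (l : AffineSubspace ℝ Plane) (L : List (AffineSubspace ℝ Plane))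
      (run : IsLineGreedyRun S c L) (unfinished : ¬ Separates S c L)
      (candidate : IsCandidateLine S l)
      (greedy : ∀ l', IsCandidateLine S l' → gain S c L l' ≤ gain S c L l) :
      IsLineGreedyRun S c (l :: L)

/-- `L` is a possible output of line-greedy: a run that has reached its stopping condition. -/
def IsLineGreedyOutput {k : ℕ} (S : Finset Plane) (c : Plane → Fin k)
    (L : List (AffineSubspace ℝ Plane)) : Prop :=
  IsLineGreedyRun S c L ∧ Separates S c L

open Classical in
/-- The parts of `S` induced by `L`: one for each face of the arrangement of `L` that contains
points of `S`. -/
noncomputable def inducedParts (S : Finset Plane) (L : List (AffineSubspace ℝ Plane)) :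
    Finset (Finset Plane) :=
  S.powerset.filter fun I => I.Nonempty ∧ ∃ F, IsFace L F ∧ (I : Set Plane) = (S : Set Plane) ∩ F

/-! Let m be the optimal number of islands. The heart of the proof is `exists_separating_lines`: at
most 5m candidate lines separate any two points in different islands of an optimal partition, hence
every bichromatic pair. At each greedy step one of these lines separates at least a 1/(5m) fraction
of the remaining pairs, and the greedy line does no worse. At most n² ordered pairs thus decay by a
factor 1 - 1/(5m) per step, and greedy stops with ℓ ≤ 1 + 10 m log n lines. These lines cut S into
at most (ℓ + 1)² parts, which is O(m² log² n). Faces are convex, so the parts are islands with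
disjoint hulls.

The 5m lines are two vertical lines per island, just outside its range of abscissas, and one
non-vertical line per pair of islands that are vertically adjacent at the abscissa of some point of
S. A charging argument (`card_directlyAbove_le`) bounds the adjacent pairs by 3m. If no vertical
line separates a from b, the islands present at their two abscissas agree, and they occur in the
same vertical order. The line just above the lower point's island then separates a from b.

The parts are counted by sign vectors with respect to the lines: three lines are never shattered, so
Sauer–Shelah gives a quadratic bound. -/

/-! ### Lines as zero sets of affine forms. -/

/-- The affine form `α x + β y - t` on the plane. -/
def affForm (α β t : ℝ) (p : Plane) : ℝ := α * p 0 + β * p 1 - t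

theorem continuous_affForm (α β t : ℝ) : Continuous (affForm α β t) := by
  unfold affForm; fun_prop

theorem affForm_lineMap (α β t : ℝ) (p q : Plane) (r : ℝ) :
    affForm α β t (AffineMap.lineMap p q r) =
      (1 - r) * affForm α β t p + r * affForm α β t q := by
  simp only [affForm, AffineMap.lineMap_apply, vsub_eq_sub, vadd_eq_add, PiLp.add_apply,
    PiLp.smul_apply, PiLp.sub_apply, smul_eq_mul]
  ring

/-- Every line is the zero set of an affine form. -/
theorem exists_affForm_of_finrank_eq_one (l : AffineSubspace ℝ Plane)
    (h : Module.finrank ℝ l.direction = 1) :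
    ∃ α β t : ℝ, ∀ p, p ∈ l ↔ affForm α β t p = 0 := by
  have hne : (l : Set Plane).Nonempty := by
    rw [AffineSubspace.nonempty_iff_ne_bot]
    rintro rfl
    rw [AffineSubspace.direction_bot, finrank_bot] at h
    exact zero_ne_one h
  obtain ⟨o, ho⟩ := hne
  obtain ⟨⟨d, hd⟩, hd0, hspan⟩ := finrank_eq_one_iff'.1 h
  have hd0' : d ≠ 0 := fun e => hd0 (Subtype.ext e)
  refine ⟨-d 1, d 0, -d 1 * o 0 + d 0 * o 1, fun p => ?_⟩
  have hmem : p ∈ l ↔ p - o ∈ l.direction := by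
    rw [← vsub_eq_sub, AffineSubspace.vsub_right_mem_direction_iff_mem ho]
  rw [hmem]
  constructor
  · intro hp
    obtain ⟨c, hc⟩ := hspan ⟨p - o, hp⟩
    have hc' : c • d = p - o := congrArg Subtype.val hc
    have h0 := congrArg (fun v : Plane => v 0) hc'
    have h1 := congrArg (fun v : Plane => v 1) hc'
    simp at h0 h1
    unfold affForm
    linear_combination d 1 * h0 - d 0 * h1
  · intro hp
    unfold affForm at hp
    have hdd : d 0 ^ 2 + d 1 ^ 2 ≠ 0 := by
      intro e
      apply hd0'
      ext i
      fin_cases i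
      · simp; nlinarith [sq_nonneg (d 0), sq_nonneg (d 1)]
      · simp; nlinarith [sq_nonneg (d 0), sq_nonneg (d 1)]
    -- A vector orthogonal to the normal (-d 1, d 0) equals its orthogonal projection onto `d`.
    have : p - o = (((p 0 - o 0) * d 0 + (p 1 - o 1) * d 1) / (d 0 ^ 2 + d 1 ^ 2)) • d := by
      ext i
      fin_cases i
      · simp
        field_simp
        linear_combination d 1 * -hp
      · simp
        field_simp
        linear_combination d 0 * hp
    rw [this]
    exact l.direction.smul_mem _ hd

/-- The zero set of a non-constant affine form is a line. -/
theorem exists_line_of_affForm (α β t : ℝ) (h : α ^ 2 + β ^ 2 ≠ 0) :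
    ∃ l : AffineSubspace ℝ Plane, Module.finrank ℝ l.direction = 1 ∧
      ∀ p, p ∈ l ↔ affForm α β t p = 0 := by
  set d : Plane := !₂[-β, α] with hd
  set o : Plane := !₂[t / (α ^ 2 + β ^ 2) * α, t / (α ^ 2 + β ^ 2) * β] with ho
  have hd0 : d ≠ 0 := by
    intro e
    have h0 := congrArg (fun v : Plane => v 0) e
    have h1 := congrArg (fun v : Plane => v 1) e
    simp [hd] at h0 h1
    simp [h0, h1] at h
  refine ⟨AffineSubspace.mk' o (Submodule.span ℝ {d}), ?_, fun p => ?_⟩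
  · rw [AffineSubspace.direction_mk', finrank_span_singleton hd0]
  · rw [AffineSubspace.mem_mk', Submodule.mem_span_singleton]
    constructor
    · rintro ⟨c, hc⟩
      have h0 := congrArg (fun v : Plane => v 0) hc
      have h1 := congrArg (fun v : Plane => v 1) hc
      simp [hd, ho] at h0 h1
      unfold affForm
      have : t / (α ^ 2 + β ^ 2) * (α ^ 2 + β ^ 2) = t := by field_simp
      linear_combination -α * h0 - β * h1 + this
    · intro hp
      unfold affForm at hp
      refine ⟨(-β * p 0 + α * p 1) / (α ^ 2 + β ^ 2), ?_⟩
      ext i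
      fin_cases i
      · simp [hd, ho]
        field_simp
        linear_combination -α * hp
      · simp [hd, ho]
        field_simp
        linear_combination -β * hp

/-- Along a segment the form is affine in the parameter, so for nonzero end values it vanishes on
the segment iff they have opposite signs. -/
theorem sOppSide_iff_affForm {l : AffineSubspace ℝ Plane} {α β t : ℝ}
    (hl : ∀ p, p ∈ l ↔ affForm α β t p = 0) (p q : Plane) :
    l.SOppSide p q ↔ affForm α β t p * affForm α β t q < 0 := by
  rw [AffineSubspace.SOppSide, AffineSubspace.wOppSide_iff_exists_wbtw, hl, hl]
  constructor
  · rintro ⟨⟨z, hz, r, hr, rfl⟩, hp, hq⟩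
    rw [hl, affForm_lineMap] at hz
    obtain ⟨hr0, hr1⟩ := hr
    by_contra hcon
    push Not at hcon
    rcases lt_or_gt_of_ne hp with hp | hp <;> rcases lt_or_gt_of_ne hq with hq | hq 
    · rcases hr0.eq_or_lt with rfl | h0
      · linarith
      · nlinarith [mul_pos_of_neg_of_neg (neg_lt_zero.2 h0) hq]
    · nlinarith
    · nlinarith
    · rcases hr0.eq_or_lt with rfl | h0
      · linarith
      · nlinarith [mul_pos h0 hq]
  · intro h
    have hp : affForm α β t p ≠ 0 := by rintro e; simp [e] at h
    have hq : affForm α β t q ≠ 0 := by rintro e; simp [e] at h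
    refine ⟨?_, hp, hq⟩
    set a := affForm α β t p
    set b := affForm α β t q
    have hab : a - b ≠ 0 := by
      intro e
      have : a = b := by linarith
      rw [this] at h
      nlinarith [sq_nonneg b]
    refine ⟨AffineMap.lineMap p q (a / (a - b)), ?_, a / (a - b), ⟨?_, ?_⟩, rfl⟩
    · rw [hl, affForm_lineMap]
      change (1 - a / (a - b)) * a + a / (a - b) * b = 0
      field_simp
      ring
    · rcases hab.lt_or_gt with h1 | h1
      · exact div_nonneg_of_nonpos (by nlinarith) h1.le
      · exact div_nonneg (by nlinarith) h1.le
    · rcases hab.lt_or_gt with h1 | h1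
      · rw [div_le_one_of_neg h1]; nlinarith
      · rw [div_le_one h1]; nlinarith

/-! ### Faces of an arrangement and the parts they induce. -/

/-- The union of the lines of a list. -/
def lineUnion (L : List (AffineSubspace ℝ Plane)) : Set Plane := ⋃ l ∈ L, (l : Set Plane)

theorem notMem_lineUnion {L : List (AffineSubspace ℝ Plane)} {x : Plane} :
    x ∈ (lineUnion L)ᶜ ↔ ∀ l ∈ L, x ∉ l := by
  simp [lineUnion]

theorem segment_subset_compl_lineUnion {L : List (AffineSubspace ℝ Plane)} {p q : Plane}
    (hp : ∀ l ∈ L, p ∉ l) (hq : ∀ l ∈ L, q ∉ l) (h : ∀ l ∈ L, ¬ l.SOppSide p q) :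
    segment ℝ p q ⊆ (lineUnion L)ᶜ := by
  intro z hz
  rw [notMem_lineUnion]
  intro l hl hzl
  refine h l hl ⟨?_, hp l hl, hq l hl⟩
  rw [AffineSubspace.wOppSide_iff_exists_wbtw]
  exact ⟨z, hzl, mem_segment_iff_wbtw.1 hz⟩

/-- Two points lie in the same face of a line arrangement iff no line separates them. -/
theorem mem_connectedComponentIn_lineUnion_iff {L : List (AffineSubspace ℝ Plane)}
    (hL : ∀ l ∈ L, Module.finrank ℝ l.direction = 1) {p q : Plane}
    (hp : ∀ l ∈ L, p ∉ l) (hq : ∀ l ∈ L, q ∉ l) :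
    q ∈ connectedComponentIn (lineUnion L)ᶜ p ↔ ∀ l ∈ L, ¬ l.SOppSide p q := by
  constructor
  · intro h l hl hopp
    obtain ⟨α, β, t, hf⟩ := exists_affForm_of_finrank_eq_one l (hL l hl)
    rw [sOppSide_iff_affForm hf] at hopp
    have hpc : IsPreconnected (connectedComponentIn (lineUnion L)ᶜ p) :=
      isPreconnected_connectedComponentIn
    -- The image of the connected face under the form is an interval; opposite signs at `p` and `q`
    -- would force it to contain 0.
    have himg := (hpc.image _ (continuous_affForm α β t).continuousOn).ordConnected
    have hpm := Set.mem_image_of_mem (affForm α β t)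
      (mem_connectedComponentIn (notMem_lineUnion.2 hp))
    have hqm := Set.mem_image_of_mem (affForm α β t) h
    have h0 : (0 : ℝ) ∈ affForm α β t '' connectedComponentIn (lineUnion L)ᶜ p := by
      rcases mul_neg_iff.1 hopp with ⟨h1, h2⟩ | ⟨h1, h2⟩
      · exact himg.out hqm hpm ⟨h2.le, h1.le⟩
      · exact himg.out hpm hqm ⟨h1.le, h2.le⟩
    obtain ⟨z, hz, hz0⟩ := h0
    exact notMem_lineUnion.1 (connectedComponentIn_subset _ _ hz) l hl ((hf z).2 hz0)
  · intro h
    exact (convex_segment p q).isPreconnected.subset_connectedComponentIn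
      (left_mem_segment ℝ p q) (segment_subset_compl_lineUnion hp hq h) (right_mem_segment ℝ p q)

theorem IsFace.eq_connectedComponentIn {L : List (AffineSubspace ℝ Plane)} {F : Set Plane}
    (hF : IsFace L F) {p : Plane} (hp : p ∈ F) : F = connectedComponentIn (lineUnion L)ᶜ p := by
  obtain ⟨x, -, rfl⟩ := hF
  exact connectedComponentIn_eq hp

theorem isFace_connectedComponentIn {L : List (AffineSubspace ℝ Plane)} {p : Plane}
    (hp : ∀ l ∈ L, p ∉ l) : IsFace L (connectedComponentIn (lineUnion L)ᶜ p) :=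
  ⟨p, notMem_lineUnion.2 hp, rfl⟩

theorem IsFace.notMem {L : List (AffineSubspace ℝ Plane)} {F : Set Plane}
    (hF : IsFace L F) {p : Plane} (hp : p ∈ F) : ∀ l ∈ L, p ∉ l := by
  rw [hF.eq_connectedComponentIn hp] at hp
  exact notMem_lineUnion.1 (connectedComponentIn_subset _ _ hp)

/-- No line separates two points of a face, so the segment between them misses every line and stays
in the component. -/
theorem IsFace.convex {L : List (AffineSubspace ℝ Plane)}
    (hL : ∀ l ∈ L, Module.finrank ℝ l.direction = 1) {F : Set Plane} (hF : IsFace L F) :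
    Convex ℝ F := by
  rw [convex_iff_segment_subset]
  intro x hx y hy
  have hxL := hF.notMem hx
  have hyL := hF.notMem hy
  rw [hF.eq_connectedComponentIn hx] at hy ⊢
  rw [mem_connectedComponentIn_lineUnion_iff hL hxL hyL] at hy
  exact (convex_segment x y).isPreconnected.subset_connectedComponentIn
      (left_mem_segment ℝ x y) (segment_subset_compl_lineUnion hxL hyL hy)

/-- The parts induced by a separating set of lines form an island partition. -/
theorem isIslandPartition_inducedParts {k : ℕ} {S : Finset Plane} {c : Plane → Fin k}
    {L : List (AffineSubspace ℝ Plane)} (h : Separates S c L) :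
    IsIslandPartition S c (inducedParts S L) := by
  classical
  have hL : ∀ l ∈ L, Module.finrank ℝ l.direction = 1 := fun l hl => (h.1 l hl).1
  have hull : ∀ {I : Finset Plane} {F : Set Plane}, IsFace L F →
      (I : Set Plane) = (S : Set Plane) ∩ F → convexHull ℝ (I : Set Plane) ⊆ F := by
    intro I F hF hI
    refine convexHull_min ?_ (hF.convex hL)
    rw [hI]
    exact Set.inter_subset_right
  constructor
  · intro I hI
    exact (Finset.mem_filter.1 hI).2.1
  · intro I hI
    obtain ⟨-, -, F, hF, hIF⟩ := Finset.mem_filter.1 hI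
    refine Set.Subset.antisymm (fun x hx => ?_) (fun x hx => ⟨subset_convexHull ℝ _ hx, ?_⟩)
    · rw [hIF]
      exact ⟨hx.2, hull hF hIF hx.1⟩
    · rw [hIF] at hx
      exact hx.1
  · intro I hI
    obtain ⟨-, -, F, hF, hIF⟩ := Finset.mem_filter.1 hI
    rw [hIF]
    exact h.2 F hF
  · intro p hp
    have hpL : ∀ l ∈ L, p ∉ l := fun l hl => (h.1 l hl).2 p hp
    have hpF := mem_connectedComponentIn (notMem_lineUnion.2 hpL)
    have hpI : p ∈ S.filter (· ∈ connectedComponentIn (lineUnion L)ᶜ p) :=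
      Finset.mem_filter.2 ⟨hp, hpF⟩
    refine ⟨_, Finset.mem_filter.2 ⟨Finset.mem_powerset.2 (Finset.filter_subset _ _), ⟨p, hpI⟩,
      _, isFace_connectedComponentIn hpL, ?_⟩, hpI⟩
    ext x
    simp
  · intro I hI J hJ hne
    obtain ⟨-, -, F, hF, hIF⟩ := Finset.mem_filter.1 hI
    obtain ⟨-, -, G, hG, hJG⟩ := Finset.mem_filter.1 hJ
    rw [Set.disjoint_left]
    intro x hxI hxJ
    apply hne
    have e : F = G := by
      rw [hF.eq_connectedComponentIn (hull hF hIF hxI),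
        hG.eq_connectedComponentIn (hull hG hJG hxJ)]
    rw [← Finset.coe_inj, hIF, hJG, e]

/-- Candidate lines separate the colours iff every bichromatic pair is separated by a line. -/
theorem separates_iff {k : ℕ} {S : Finset Plane} {c : Plane → Fin k}
    {L : List (AffineSubspace ℝ Plane)} (hL : ∀ l ∈ L, IsCandidateLine S l) :
    Separates S c L ↔ ∀ p ∈ S, ∀ q ∈ S, c p ≠ c q → ∃ l ∈ L, l.SOppSide p q := by
  have hd : ∀ l ∈ L, Module.finrank ℝ l.direction = 1 := fun l hl => (hL l hl).1
  have hS : ∀ p ∈ S, ∀ l ∈ L, p ∉ l := fun p hp l hl => (hL l hl).2 p hp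
  constructor
  · rintro ⟨-, h⟩ p hp q hq hc
    by_contra hcon
    push Not at hcon
    exact hc (h _ (isFace_connectedComponentIn (hS p hp))
      p ⟨hp, mem_connectedComponentIn (notMem_lineUnion.2 (hS p hp))⟩
      q ⟨hq, (mem_connectedComponentIn_lineUnion_iff hd (hS p hp) (hS q hq)).2 hcon⟩)
  · intro h
    refine ⟨hL, fun F hF p hp q hq => ?_⟩
    by_contra hc
    obtain ⟨l, hl, hopp⟩ := h p hp.1 q hq.1 hc
    have hq2 := hq.2
    rw [hF.eq_connectedComponentIn hp.2,
      mem_connectedComponentIn_lineUnion_iff hd (hS p hp.1) (hS q hq.1)] at hq2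
    exact hq2 l hl hopp

/-! ### Counting parts by VC dimension. -/

/-- The parameters of an affine form whose zero set is a given line. -/
noncomputable def lineParams (l : AffineSubspace ℝ Plane)
    (h : Module.finrank ℝ l.direction = 1) : ℝ × ℝ × ℝ :=
  let h1 := exists_affForm_of_finrank_eq_one l h
  (h1.choose, h1.choose_spec.choose, h1.choose_spec.choose_spec.choose)

theorem mem_iff_lineParams (l : AffineSubspace ℝ Plane)
    (h : Module.finrank ℝ l.direction = 1) (p : Plane) :
    p ∈ l ↔ affForm (lineParams l h).1 (lineParams l h).2.1 (lineParams l h).2.2 p = 0 :=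
  (exists_affForm_of_finrank_eq_one l h).choose_spec.choose_spec.choose_spec p

/-- Affine forms on the plane without zeros in `S` realise only sign sets of VC dimension at
most `2`. -/
theorem vcDim_signSets_le_two {ι : Type*} [Fintype ι] [DecidableEq ι] (S : Finset Plane)
    (α β t : ι → ℝ)
    (h : ∀ i, ∀ p ∈ S, affForm (α i) (β i) (t i) p ≠ 0) :
    (S.image fun p => Finset.univ.filter fun i => 0 < affForm (α i) (β i) (t i) p).vcDim ≤ 2 := by
  classical
  refine Finset.sup_le fun s hs => ?_
  rw [Finset.mem_shatterer] at hs
  by_contra hcard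
  push Not at hcard
  -- More than two normals in ℝ² are dependent; the same combination of the affine forms is then
  -- constant.
  have hdep : ¬ LinearIndependent ℝ (fun i : s => (α i, β i)) := by
    intro hli
    have := hli.fintype_card_le_finrank
    simp at this
    omega
  obtain ⟨a, ha, j, hj⟩ := Fintype.not_linearIndependent_iff.1 hdep
  have hα : ∑ i : s, a i * α i = 0 := by
    have := congrArg Prod.fst ha
    simpa [Prod.fst_sum] using this
  have hβ : ∑ i : s, a i * β i = 0 := by
    have := congrArg Prod.snd ha
    simpa [Prod.snd_sum] using this
  have hconst : ∀ p, ∑ i : s, a i * affForm (α i) (β i) (t i) p = -∑ i : s, a i * t i := by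
    intro p
    have : ∀ i : s, a i * affForm (α i) (β i) (t i) p =
        (a i * α i) * p 0 + (a i * β i) * p 1 - a i * t i := by
      intro i; unfold affForm; ring
    simp_rw [this]
    rw [Finset.sum_sub_distrib, Finset.sum_add_distrib, ← Finset.sum_mul, ← Finset.sum_mul, hα, hβ]
    ring
  -- Shattering yields a point of `S` whose sign vector on `s` matches that of `b`, so all terms
  -- with nonzero coefficient are positive. Used for `a` and for `-a`, this makes the constant both
  -- positive and negative.
  have key : ∀ b : s → ℝ, b j ≠ 0 → ∃ p, 0 < ∑ i : s, b i * affForm (α i) (β i) (t i) p := by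
    intro b hb
    obtain ⟨u, hu, hsu⟩ := hs (t := s.filter fun i => ∃ hi : i ∈ s, 0 < b ⟨i, hi⟩)
      (Finset.filter_subset _ _)
    obtain ⟨p, hp, rfl⟩ := Finset.mem_image.1 hu
    have hsign : ∀ i : s, 0 < affForm (α i) (β i) (t i) p ↔ 0 < b i := by
      intro i
      have := congrArg (fun w => (i : ι) ∈ w) hsu
      simpa using this
    have hpos : ∀ i : s, b i ≠ 0 → 0 < b i * affForm (α i) (β i) (t i) p := by
      intro i hi
      rcases lt_or_gt_of_ne hi with h1 | h1
      · have h2 : ¬ 0 < affForm (α i) (β i) (t i) p := fun h3 => by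
          have := (hsign i).1 h3
          linarith
        exact mul_pos_of_neg_of_neg h1 (lt_of_le_of_ne (not_lt.1 h2) (h i p hp))
      · exact mul_pos h1 ((hsign i).2 h1)
    refine ⟨p, Finset.sum_pos' (fun i _ => ?_) ⟨j, Finset.mem_univ _, hpos j hb⟩⟩
    by_cases hi : b i = 0
    · simp [hi]
    · exact (hpos i hi).le
  obtain ⟨p, hp⟩ := key a hj
  obtain ⟨q, hq⟩ := key (fun i => -a i) (neg_ne_zero.2 hj)
  rw [hconst] at hp
  simp only [neg_mul, Finset.sum_neg_distrib] at hq
  rw [hconst] at hq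
  linarith

/-- Sauer–Shelah for VC dimension at most `2`. -/
theorem card_le_of_vcDim_le_two {ι : Type*} [Fintype ι] [DecidableEq ι]
    (𝒜 : Finset (Finset ι)) (h : 𝒜.vcDim ≤ 2) : 𝒜.card ≤ (Fintype.card ι + 1) ^ 2 := by
  have h1 : 𝒜.card ≤ ∑ k ∈ Finset.Iic 2, (Fintype.card ι).choose k :=
    (𝒜.card_le_card_shatterer.trans Finset.card_shatterer_le_sum_vcDim).trans
      (Finset.sum_le_sum_of_subset (Finset.Iic_subset_Iic.2 h))
  have h2 : Finset.Iic 2 = ({0, 1, 2} : Finset ℕ) := by decide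
  rw [h2] at h1
  simp at h1
  have h3 : (Fintype.card ι).choose 2 ≤ Fintype.card ι ^ 2 := Nat.choose_le_pow _ _
  nlinarith

/-- An arrangement of `ℓ` lines induces at most `(ℓ + 1) ^ 2` parts. -/
theorem card_inducedParts_le {S : Finset Plane} {L : List (AffineSubspace ℝ Plane)}
    (hL : ∀ l ∈ L, IsCandidateLine S l) : (inducedParts S L).card ≤ (L.length + 1) ^ 2 := by
  classical
  have hfin : ∀ i : Fin L.length, Module.finrank ℝ (L.get i).direction = 1 :=
    fun i => (hL _ (L.get_mem i)).1
  have hd : ∀ l ∈ L, Module.finrank ℝ l.direction = 1 := fun l hl => (hL l hl).1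
  let P := fun i => lineParams (L.get i) (hfin i)
  let σ : Plane → Finset (Fin L.length) := fun p =>
    Finset.univ.filter fun i => 0 < affForm (P i).1 (P i).2.1 (P i).2.2 p
  have hne : ∀ i, ∀ p ∈ S, affForm (P i).1 (P i).2.1 (P i).2.2 p ≠ 0 := by
    intro i p hp h0
    exact (hL _ (L.get_mem i)).2 p hp ((mem_iff_lineParams _ (hfin i) p).2 h0)
  have hcard := card_le_of_vcDim_le_two _ (vcDim_signSets_le_two S _ _ _ hne)
  rw [Fintype.card_fin] at hcard
  refine le_trans ?_ hcard
  have hpt : ∀ I ∈ inducedParts S L, I.Nonempty := fun I hI => (Finset.mem_filter.1 hI).2.1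
  let pt : Finset Plane → Plane := fun I => if h : I.Nonempty then h.choose else 0
  have hptm : ∀ I ∈ inducedParts S L, pt I ∈ I := by
    intro I hI
    have := hpt I hI
    simp only [pt, this, dif_pos]
    exact this.choose_spec
  -- A part is determined by the sign vector of any of its points: equal vectors mean that no line
  -- separates the points, so their faces coincide.
  refine Finset.card_le_card_of_injOn (fun I => σ (pt I)) ?_ ?_
  · intro I hI
    have hsub := Finset.mem_powerset.1 (Finset.mem_filter.1 hI).1
    exact Finset.mem_coe.2 (Finset.mem_image_of_mem _ (hsub (hptm I hI)))
  · intro I hI J hJ hIJ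
    obtain ⟨-, -, F, hF, hIF⟩ := Finset.mem_filter.1 hI
    obtain ⟨-, -, G, hG, hJG⟩ := Finset.mem_filter.1 hJ
    have hp : pt I ∈ (S : Set Plane) ∩ F := by rw [← hIF]; exact hptm I hI
    have hq : pt J ∈ (S : Set Plane) ∩ G := by rw [← hJG]; exact hptm J hJ
    have hS : ∀ p ∈ S, ∀ l ∈ L, p ∉ l := fun p hp l hl => (hL l hl).2 p hp
    have hFG : F = G := by
      have : pt J ∈ F := by
        rw [hF.eq_connectedComponentIn hp.2,
          mem_connectedComponentIn_lineUnion_iff hd (hS _ hp.1) (hS _ hq.1)]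
        intro l hl
        obtain ⟨i, rfl⟩ := List.mem_iff_get.1 hl
        rw [sOppSide_iff_affForm (mem_iff_lineParams _ (hfin i))]
        have hiff : 0 < affForm (P i).1 (P i).2.1 (P i).2.2 (pt I) ↔
            0 < affForm (P i).1 (P i).2.1 (P i).2.2 (pt J) := by
          have := congrArg (fun w => i ∈ w) hIJ
          simpa [σ] using this
        intro hneg
        rcases mul_neg_iff.1 hneg with ⟨h1, h2⟩ | ⟨h1, h2⟩
        · have := hiff.1 h1
          exact lt_asymm this h2
        · have := hiff.2 h2
          exact lt_asymm this h1
      rw [hF.eq_connectedComponentIn this, hG.eq_connectedComponentIn hq.2]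
    rw [← Finset.coe_inj, hIF, hJG, hFG]

/-! ### Vertical adjacency: the charging argument. -/

section Adjacency

variable {κ : Type*}

/-- At abscissa `v`, the set `B` lies directly above the set `A` among the members of `P` present
at `v`. Here `A` is present on `[lo A, hi A]`, where it has height `ht v A`. -/
def DirectlyAbove (P : Finset κ) (lo hi : κ → ℝ) (ht : ℝ → κ → ℝ) (v : ℝ) (A B : κ) : Prop :=
  (A ∈ P ∧ lo A ≤ v ∧ v ≤ hi A) ∧ (B ∈ P ∧ lo B ≤ v ∧ v ≤ hi B) ∧ ht v A < ht v B ∧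
    ∀ C ∈ P, lo C ≤ v → v ≤ hi C → ht v A < ht v C → ht v B ≤ ht v C

variable {P : Finset κ} {lo hi : κ → ℝ} {ht : ℝ → κ → ℝ}

theorem exists_directlyAbove {v : ℝ} {A B : κ} (hA : A ∈ P) (hAl : lo A ≤ v) (hAh : v ≤ hi A)
    (hB : B ∈ P) (hBl : lo B ≤ v) (hBh : v ≤ hi B) (hlt : ht v A < ht v B) :
    ∃ C, DirectlyAbove P lo hi ht v A C ∧ ht v C ≤ ht v B := by
  classical
  obtain ⟨C, hC, hmin⟩ := Finset.exists_min_image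
    (P.filter fun C => lo C ≤ v ∧ v ≤ hi C ∧ ht v A < ht v C) (ht v)
    ⟨B, Finset.mem_filter.2 ⟨hB, hBl, hBh, hlt⟩⟩
  obtain ⟨hCP, hCl, hCh, hAC⟩ := Finset.mem_filter.1 hC
  refine ⟨C, ⟨⟨hA, hAl, hAh⟩, ⟨hCP, hCl, hCh⟩, hAC, fun D hD hDl hDh hAD => ?_⟩, ?_⟩
  · exact hmin D (Finset.mem_filter.2 ⟨hD, hDl, hDh, hAD⟩)
  · exact hmin B (Finset.mem_filter.2 ⟨hB, hBl, hBh, hlt⟩)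

theorem DirectlyAbove.right_unique
    (hinj : ∀ v, ∀ A ∈ P, ∀ B ∈ P, lo A ≤ v → v ≤ hi A → lo B ≤ v → v ≤ hi B →
      ht v A = ht v B → A = B)
    {v : ℝ} {A B B' : κ} (h : DirectlyAbove P lo hi ht v A B)
    (h' : DirectlyAbove P lo hi ht v A B') : B = B' := by
  obtain ⟨-, ⟨hB, hBl, hBh⟩, hAB, hm⟩ := h
  obtain ⟨-, ⟨hB', hBl', hBh'⟩, hAB', hm'⟩ := h'
  exact hinj v B hB B' hB' hBl hBh hBl' hBh'
    (le_antisymm (hm B' hB' hBl' hBh' hAB') (hm' B hB hBl hBh hAB))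

theorem DirectlyAbove.left_unique
    (hinj : ∀ v, ∀ A ∈ P, ∀ B ∈ P, lo A ≤ v → v ≤ hi A → lo B ≤ v → v ≤ hi B →
      ht v A = ht v B → A = B)
    {v : ℝ} {A A' B : κ} (h : DirectlyAbove P lo hi ht v A B)
    (h' : DirectlyAbove P lo hi ht v A' B) : A = A' := by
  obtain ⟨⟨hA, hAl, hAh⟩, -, hAB, hm⟩ := h
  obtain ⟨⟨hA', hAl', hAh'⟩, -, hAB', hm'⟩ := h'
  refine hinj v A hA A' hA' hAl hAh hAl' hAh' (le_antisymm ?_ ?_)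
  · by_contra hlt
    exact absurd (hm' A hA hAl hAh (not_le.1 hlt)) (not_le.2 hAB)
  · by_contra hlt
    exact absurd (hm A' hA' hAl' hAh' (not_le.1 hlt)) (not_le.2 hAB')

open Classical in
/-- Only linearly many pairs are vertically adjacent at some abscissa. -/
theorem card_directlyAbove_le
    (hinj : ∀ v, ∀ A ∈ P, ∀ B ∈ P, lo A ≤ v → v ≤ hi A → lo B ≤ v → v ≤ hi B →
      ht v A = ht v B → A = B)
    (V : Finset ℝ) (hlo : ∀ A ∈ P, lo A ∈ V) (hhi : ∀ A ∈ P, hi A ∈ V)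
    (hcons : ∀ u v, ∀ A ∈ P, ∀ B ∈ P, lo A ≤ u → u ≤ hi A → lo B ≤ u → u ≤ hi B →
      lo A ≤ v → v ≤ hi A → lo B ≤ v → v ≤ hi B → ht u A < ht u B → ht v A < ht v B) :
    ((P ×ˢ P).filter fun AB => ∃ v ∈ V, DirectlyAbove P lo hi ht v AB.1 AB.2).card ≤
      3 * P.card := by
  -- Each adjacent pair (A, B) is charged at the first abscissa of `V` where it is adjacent: to A if
  -- A starts there (`Q₁`), to B if B starts there (`Q₂`), otherwise to a set C between them that
  -- has just ended (`Q₃`). Each set receives at most one charge of each kind.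
  let Q₁ := (P ×ˢ P).filter fun AB => DirectlyAbove P lo hi ht (lo AB.1) AB.1 AB.2
  let Q₂ := (P ×ˢ P).filter fun AB => DirectlyAbove P lo hi ht (lo AB.2) AB.1 AB.2
  let R : κ × κ → κ → Prop := fun AB C => C ∈ P ∧ DirectlyAbove P lo hi ht (hi C) AB.1 C ∧
    ∃ v ∈ V, hi C < v ∧ (∀ w ∈ V, hi C < w → v ≤ w) ∧ DirectlyAbove P lo hi ht v AB.1 AB.2
  let Q₃ := (P ×ˢ P).filter fun AB => ∃ C, R AB C
  have h₁ : Q₁.card ≤ P.card := by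
    refine Finset.card_le_card_of_injOn Prod.fst (fun x hx => ?_) ?_
    · exact (Finset.mem_product.1 (Finset.mem_filter.1 hx).1).1
    · rintro ⟨A, B⟩ hx ⟨A', B'⟩ hy (rfl : A = A')
      have hx := (Finset.mem_filter.1 hx).2
      have hy := (Finset.mem_filter.1 hy).2
      rw [Prod.mk.injEq]
      exact ⟨rfl, DirectlyAbove.right_unique hinj hx hy⟩
  have h₂ : Q₂.card ≤ P.card := by
    refine Finset.card_le_card_of_injOn Prod.snd (fun x hx => ?_) ?_
    · exact (Finset.mem_product.1 (Finset.mem_filter.1 hx).1).2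
    · rintro ⟨A, B⟩ hx ⟨A', B'⟩ hy (rfl : B = B')
      have hx := (Finset.mem_filter.1 hx).2
      have hy := (Finset.mem_filter.1 hy).2
      rw [Prod.mk.injEq]
      exact ⟨DirectlyAbove.left_unique hinj hx hy, rfl⟩
  -- C recovers the pair: A lies directly below C at `hi C`, and B lies directly above A at the
  -- successor of `hi C` in `V`.
  have h₃ : Q₃.card ≤ P.card := by
    refine Finset.card_le_card_of_forall_subsingleton R (fun x hx => ?_) ?_
    · obtain ⟨C, hC⟩ := (Finset.mem_filter.1 hx).2
      exact ⟨C, hC.1, hC⟩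
    · rintro C - ⟨A, B⟩ ⟨-, -, h1, v, hv, hCv, hmin, hAB⟩
        ⟨A', B'⟩ ⟨-, -, h1', v', hv', hCv', hmin', hAB'⟩
      obtain rfl : v = v' := le_antisymm (hmin v' hv' hCv') (hmin' v hv hCv)
      obtain rfl : A = A' := DirectlyAbove.left_unique hinj h1 h1'
      rw [Prod.mk.injEq]
      exact ⟨rfl, DirectlyAbove.right_unique hinj hAB hAB'⟩
  have hsub : ((P ×ˢ P).filter fun AB => ∃ v ∈ V, DirectlyAbove P lo hi ht v AB.1 AB.2) ⊆
      Q₁ ∪ Q₂ ∪ Q₃ := by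
    rintro ⟨A, B⟩ hAB
    obtain ⟨hprod, v₀, hv₀, hd₀⟩ := Finset.mem_filter.1 hAB
    obtain ⟨v, hvm, hmin⟩ := Finset.exists_min_image
      (V.filter fun v => DirectlyAbove P lo hi ht v A B) id ⟨v₀, Finset.mem_filter.2 ⟨hv₀, hd₀⟩⟩
    obtain ⟨hv, hd⟩ := Finset.mem_filter.1 hvm
    obtain ⟨⟨hA, hAl, hAh⟩, ⟨hB, hBl, hBh⟩, hlt, hup⟩ := hd
    rcases hAl.eq_or_lt with e | hAl'
    · exact Finset.mem_union_left _ (Finset.mem_union_left _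
        (Finset.mem_filter.2 ⟨hprod, by rw [e]; exact (Finset.mem_filter.1 hvm).2⟩))
    rcases hBl.eq_or_lt with e | hBl'
    · exact Finset.mem_union_left _ (Finset.mem_union_right _
        (Finset.mem_filter.2 ⟨hprod, by rw [e]; exact (Finset.mem_filter.1 hvm).2⟩))
    -- At the predecessor `u` of `v` both sets are present in the same order but, by minimality of
    -- `v`, not adjacent; so some C lies between them.
    obtain ⟨u, hum, humax⟩ := Finset.exists_max_image (V.filter (· < v)) id
      ⟨lo A, Finset.mem_filter.2 ⟨hlo A hA, hAl'⟩⟩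
    obtain ⟨hu, huv⟩ := Finset.mem_filter.1 hum
    have hAu : lo A ≤ u := humax _ (Finset.mem_filter.2 ⟨hlo A hA, hAl'⟩)
    have hBu : lo B ≤ u := humax _ (Finset.mem_filter.2 ⟨hlo B hB, hBl'⟩)
    have hAu' : u ≤ hi A := huv.le.trans hAh
    have hBu' : u ≤ hi B := huv.le.trans hBh
    have hltu := hcons v u A hA B hB hAl hAh hBl hBh hAu hAu' hBu hBu' hlt
    obtain ⟨C, hC, hCB⟩ := exists_directlyAbove hA hAu hAu' hB hBu hBu' hltu
    obtain ⟨-, ⟨hCP, hCl, hCh⟩, hAC, -⟩ := id hC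
    have hCB' : ht u C < ht u B := by
      refine lt_of_le_of_ne hCB fun e => ?_
      obtain rfl := hinj u C hCP B hB hCl hCh hBu hBu' e
      have := hmin u (Finset.mem_filter.2 ⟨hu, hC⟩)
      exact absurd this (not_le.2 huv)
    -- If C survived to `v`, order consistency would keep it strictly between A and B.
    have hCv : hi C < v := by
      by_contra hle
      rw [not_lt] at hle
      have hCl' := hCl.trans huv.le
      have h1 := hcons u v A hA C hCP hAu hAu' hCl hCh hAl hAh hCl' hle hAC
      have h2 := hcons u v C hCP B hB hCl hCh hBu hBu' hCl' hle hBl hBh hCB'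
      exact absurd (hup C hCP hCl' hle h1) (not_le.2 h2)
    have hCu : hi C = u := le_antisymm (humax _ (Finset.mem_filter.2 ⟨hhi C hCP, hCv⟩)) hCh
    refine Finset.mem_union_right _ (Finset.mem_filter.2 ⟨hprod, C, hCP, by rw [hCu]; exact hC,
      v, hv, hCv, fun w hw hCw => ?_, (Finset.mem_filter.1 hvm).2⟩)
    by_contra hwv
    have := humax w (Finset.mem_filter.2 ⟨hw, not_le.1 hwv⟩)
    rw [hCu] at hCw
    exact absurd this (not_le.2 hCw)
  have := Finset.card_le_card hsub
  have := Finset.card_union_le (Q₁ ∪ Q₂) Q₃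
  have := Finset.card_union_le Q₁ Q₂
  omega

end Adjacency

/-! ### Separating disjoint hulls by few lines. -/

/-- The abscissas of the points of the convex hull of `A`. -/
def xRange (A : Finset Plane) : Set ℝ := (fun p : Plane => p 0) '' convexHull ℝ (A : Set Plane)

open Classical in
/-- The height of a chosen point of the convex hull of `A` with abscissa `v`. -/
noncomputable def sliceHeight (v : ℝ) (A : Finset Plane) : ℝ :=
  if h : v ∈ xRange A then h.choose 1 else 0

/-- Which point of the slice is chosen never matters, since separating lines keep whole hulls on one
side. -/
theorem exists_mem_convexHull_sliceHeight {v : ℝ} {A : Finset Plane} (h : v ∈ xRange A) :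
    ∃ p ∈ convexHull ℝ (A : Set Plane), p 0 = v ∧ p 1 = sliceHeight v A := by
  refine ⟨h.choose, h.choose_spec.1, h.choose_spec.2, ?_⟩
  simp [sliceHeight, h]

theorem isLinearMap_form (α β : ℝ) : IsLinearMap ℝ (fun p : Plane => α * p 0 + β * p 1) where
  map_add p q := by simp; ring
  map_smul r p := by simp; ring

/-- Extreme abscissas of a hull are attained at points of `A`; hence all range ends lie in the
finite projection of `S`, as the charging argument requires. -/
theorem exists_xRange_eq_Icc {A : Finset Plane} (hA : A.Nonempty) :
    ∃ a ∈ A, ∃ b ∈ A, xRange A = Set.Icc (a 0) (b 0) := by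
  obtain ⟨a, ha, hmin⟩ := A.exists_min_image (fun p => p 0) hA
  obtain ⟨b, hb, hmax⟩ := A.exists_max_image (fun p => p 0) hA
  have hlin : IsLinearMap ℝ (fun p : Plane => p 0) := by simpa using isLinearMap_form 1 0
  refine ⟨a, ha, b, hb, Set.Subset.antisymm ?_ ?_⟩
  · rintro _ ⟨p, hp, rfl⟩
    exact ⟨convexHull_min (t := {w : Plane | a 0 ≤ w 0}) (fun q hq => hmin q hq)
        (convex_halfSpace_ge hlin _) hp,
      convexHull_min (t := {w : Plane | w 0 ≤ b 0}) (fun q hq => hmax q hq)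
        (convex_halfSpace_le hlin _) hp⟩
  · have hoc : (xRange A).OrdConnected :=
      (((convex_convexHull ℝ _).isPreconnected).image _
        (by fun_prop : Continuous fun p : Plane => p 0).continuousOn).ordConnected
    exact hoc.out ⟨a, subset_convexHull ℝ _ ha, rfl⟩ ⟨b, subset_convexHull ℝ _ hb, rfl⟩

theorem exists_mem_Ioo_notMem_finset (F : Finset ℝ) {a b : ℝ} (h : a < b) :
    ∃ t ∈ Set.Ioo a b, t ∉ F :=
  (Set.Ioo_infinite h).exists_notMem_finset F

/-- A non-vertical line that strictly separates two convex hulls with a common abscissa and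
avoids `S`. -/
theorem exists_separating_line (S : Finset Plane) {A B : Finset Plane}
    (hdisj : Disjoint (convexHull ℝ (A : Set Plane)) (convexHull ℝ (B : Set Plane)))
    {v : ℝ} (hA : v ∈ xRange A) (hB : v ∈ xRange B) (hlt : sliceHeight v A < sliceHeight v B) :
    ∃ l, IsCandidateLine S l ∧ ∃ α t : ℝ, (∀ p, p ∈ l ↔ affForm α 1 t p = 0) ∧
      (∀ p ∈ convexHull ℝ (A : Set Plane), affForm α 1 t p < 0) ∧
      ∀ p ∈ convexHull ℝ (B : Set Plane), 0 < affForm α 1 t p := by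
  obtain ⟨f, u, w, hfA, huw, hfB⟩ := geometric_hahn_banach_compact_closed
    (convex_convexHull ℝ (A : Set Plane)) (A.finite_toSet.isCompact_convexHull ℝ)
    (convex_convexHull ℝ (B : Set Plane)) (B.finite_toSet.isCompact_convexHull ℝ).isClosed hdisj
  have hf : ∀ p : Plane, f p = f !₂[1, 0] * p 0 + f !₂[0, 1] * p 1 := by
    intro p
    have : p = p 0 • !₂[(1 : ℝ), 0] + p 1 • !₂[(0 : ℝ), 1] := by
      ext i
      fin_cases i <;> simp
    conv_lhs => rw [this]
    rw [map_add, map_smul, map_smul]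
    simp only [smul_eq_mul]
    ring
  set x := f !₂[1, 0]
  set y := f !₂[0, 1]
  obtain ⟨p, hp, hp0, hp1⟩ := exists_mem_convexHull_sliceHeight hA
  obtain ⟨q, hq, hq0, hq1⟩ := exists_mem_convexHull_sliceHeight hB
  -- At the common abscissa `v` the functional increases from the lower point of A to the higher
  -- point of B, so its vertical coefficient is positive and can be normalised to 1.
  have hy : 0 < y := by
    have h1 := hfA p hp
    have h2 := hfB q hq
    rw [hf, hp0, hp1] at h1
    rw [hf, hq0, hq1] at h2
    by_contra hy
    nlinarith
  obtain ⟨t, ⟨htu, htw⟩, htS⟩ := exists_mem_Ioo_notMem_finset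
    (S.image fun p => x / y * p 0 + p 1) (div_lt_div_of_pos_right huw hy)
  rw [div_lt_iff₀ hy] at htu
  rw [lt_div_iff₀ hy] at htw
  obtain ⟨l, hl, hlf⟩ := exists_line_of_affForm (x / y) 1 t (by positivity)
  have haff : ∀ p, affForm (x / y) 1 t p * y = f p - t * y := by
    intro p
    rw [hf, affForm]
    field_simp
  refine ⟨l, ⟨hl, fun p hp hpl => htS ?_⟩, x / y, t, hlf, fun p hp => ?_, fun p hp => ?_⟩
  · rw [hlf, affForm] at hpl
    exact Finset.mem_image.2 ⟨p, hp, by linarith⟩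
  · have h1 := haff p
    have h2 := hfA p hp
    by_contra hcon
    nlinarith
  · have h1 := haff p
    have h2 := hfB p hp
    by_contra hcon
    nlinarith

theorem exists_vertical_line (S : Finset Plane) (t : ℝ) (ht : ∀ p ∈ S, p 0 ≠ t) :
    ∃ l, IsCandidateLine S l ∧ ∀ p q, p 0 < t → t < q 0 → l.SOppSide p q := by
  obtain ⟨l, hl, hlf⟩ := exists_line_of_affForm 1 0 t (by norm_num)
  refine ⟨l, ⟨hl, fun p hp hpl => ht p hp ?_⟩, fun p q hp hq => ?_⟩
  · rw [hlf, affForm] at hpl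
    linarith
  · rw [sOppSide_iff_affForm hlf, affForm, affForm]
    nlinarith

-- Since `S` is finite, a vertical line close enough to `v` on its left has all points of smaller
-- abscissa on its left; points at `v` itself stay on the right.
open Filter Topology in
theorem exists_vertical_line_left (S : Finset Plane) (v : ℝ) :
    ∃ l, IsCandidateLine S l ∧ ∀ p ∈ S, ∀ q ∈ S, p 0 < v → v ≤ q 0 → l.SOppSide p q := by
  have hev : ∀ᶠ t in 𝓝[<] v, ∀ p ∈ S, p 0 < v → p 0 < t := by
    rw [Filter.eventually_all_finset]
    intro p _
    by_cases hp : p 0 < v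
    · filter_upwards [nhdsWithin_le_nhds (lt_mem_nhds hp)] with t ht _ using ht
    · exact Eventually.of_forall fun t h => absurd h hp
  obtain ⟨t, ht, htv⟩ := (hev.and self_mem_nhdsWithin).exists
  obtain ⟨l, hl, hopp⟩ := exists_vertical_line S t fun p hp e => by
    have := ht p hp (e ▸ htv)
    exact this.ne e
  exact ⟨l, hl, fun p hp q _ hpv hvq => hopp p q (ht p hp hpv) (lt_of_lt_of_le htv hvq)⟩

open Filter Topology in
theorem exists_vertical_line_right (S : Finset Plane) (v : ℝ) :
    ∃ l, IsCandidateLine S l ∧ ∀ p ∈ S, ∀ q ∈ S, p 0 ≤ v → v < q 0 → l.SOppSide p q := by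
  have hev : ∀ᶠ t in 𝓝[>] v, ∀ p ∈ S, v < p 0 → t < p 0 := by
    rw [Filter.eventually_all_finset]
    intro p _
    by_cases hp : v < p 0
    · filter_upwards [nhdsWithin_le_nhds (gt_mem_nhds hp)] with t ht _ using ht
    · exact Eventually.of_forall fun t h => absurd h hp
  obtain ⟨t, ht, htv⟩ := (hev.and self_mem_nhdsWithin).exists
  obtain ⟨l, hl, hopp⟩ := exists_vertical_line S t fun p hp e => by
    have := ht p hp (e ▸ htv)
    exact this.ne' e
  exact ⟨l, hl, fun p _ q hq hpv hvq => hopp p q (lt_of_le_of_lt hpv htv) (ht q hq hvq)⟩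

/-- Finitely many sets with pairwise disjoint convex hulls are separated, point by point, by
linearly many lines. -/
theorem exists_separating_lines (S : Finset Plane) (P : Finset (Finset Plane))
    (hne : ∀ A ∈ P, A.Nonempty) (hsub : ∀ A ∈ P, A ⊆ S)
    (hdisj : ∀ A ∈ P, ∀ B ∈ P, A ≠ B →
      Disjoint (convexHull ℝ (A : Set Plane)) (convexHull ℝ (B : Set Plane))) :
    ∃ M : Finset (AffineSubspace ℝ Plane), M.card ≤ 5 * P.card ∧ (∀ l ∈ M, IsCandidateLine S l) ∧
      ∀ A ∈ P, ∀ B ∈ P, A ≠ B → ∀ a ∈ A, ∀ b ∈ B, ∃ l ∈ M, l.SOppSide a b := by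
  classical
  have hrange : ∀ A : Finset Plane, ∃ lh : ℝ × ℝ, A ∈ P →
      lh.1 ∈ S.image (fun p => p 0) ∧ lh.2 ∈ S.image (fun p => p 0) ∧
      xRange A = Set.Icc lh.1 lh.2 := by
    intro A
    by_cases hA : A ∈ P
    · obtain ⟨a, ha, b, hb, hab⟩ := exists_xRange_eq_Icc (hne A hA)
      exact ⟨(a 0, b 0), fun _ => ⟨Finset.mem_image_of_mem _ (hsub A hA ha),
        Finset.mem_image_of_mem _ (hsub A hA hb), hab⟩⟩
    · exact ⟨0, fun h => absurd h hA⟩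
  choose lh hlh using hrange
  let lo := fun A => (lh A).1
  let hi := fun A => (lh A).2
  have hx : ∀ A ∈ P, ∀ v, lo A ≤ v → v ≤ hi A → v ∈ xRange A := by
    intro A hA v h1 h2
    rw [(hlh A hA).2.2]
    exact ⟨h1, h2⟩
  have hpt : ∀ A ∈ P, ∀ a ∈ A, lo A ≤ a 0 ∧ a 0 ≤ hi A := by
    intro A hA a ha
    have : a 0 ∈ xRange A := ⟨a, subset_convexHull ℝ _ ha, rfl⟩
    rw [(hlh A hA).2.2] at this
    exact this
  have hinj : ∀ v, ∀ A ∈ P, ∀ B ∈ P, lo A ≤ v → v ≤ hi A → lo B ≤ v → v ≤ hi B →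
      sliceHeight v A = sliceHeight v B → A = B := by
    intro v A hA B hB hAl hAh hBl hBh e
    by_contra hAB
    obtain ⟨p, hp, hp0, hp1⟩ := exists_mem_convexHull_sliceHeight (hx A hA v hAl hAh)
    obtain ⟨q, hq, hq0, hq1⟩ := exists_mem_convexHull_sliceHeight (hx B hB v hBl hBh)
    have : p = q := by
      ext i
      fin_cases i
      · exact hp0.trans hq0.symm
      · exact hp1.trans (e.trans hq1.symm)
    exact Set.disjoint_left.1 (hdisj A hA B hB hAB) hp (this ▸ hq)
  -- A non-vertical line with A below and B above at `u` does the same at every common abscissa.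
  have hcons : ∀ u v, ∀ A ∈ P, ∀ B ∈ P, lo A ≤ u → u ≤ hi A → lo B ≤ u → u ≤ hi B →
      lo A ≤ v → v ≤ hi A → lo B ≤ v → v ≤ hi B → sliceHeight u A < sliceHeight u B →
      sliceHeight v A < sliceHeight v B := by
    intro u v A hA B hB h1 h2 h3 h4 h5 h6 h7 h8 hlt
    have hAB : A ≠ B := by
      rintro rfl
      exact lt_irrefl _ hlt
    obtain ⟨l, -, α, t, -, hlA, hlB⟩ := exists_separating_line S (hdisj A hA B hB hAB)
      (hx A hA u h1 h2) (hx B hB u h3 h4) hlt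
    obtain ⟨p, hp, hp0, hp1⟩ := exists_mem_convexHull_sliceHeight (hx A hA v h5 h6)
    obtain ⟨q, hq, hq0, hq1⟩ := exists_mem_convexHull_sliceHeight (hx B hB v h7 h8)
    have h9 := hlA p hp
    have h10 := hlB q hq
    rw [affForm, hp0, hp1] at h9
    rw [affForm, hq0, hq1] at h10
    linarith
  set V := S.image (fun p : Plane => p 0) with hV
  let Q := (P ×ˢ P).filter fun AB => ∃ v ∈ V, DirectlyAbove P lo hi sliceHeight v AB.1 AB.2
  have hQ : Q.card ≤ 3 * P.card := card_directlyAbove_le hinj V (fun A hA => (hlh A hA).1)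
    (fun A hA => (hlh A hA).2.1) hcons
  have hsep : ∀ AB : Finset Plane × Finset Plane, ∃ l, AB ∈ Q → IsCandidateLine S l ∧
      ∃ α t : ℝ, (∀ p, p ∈ l ↔ affForm α 1 t p = 0) ∧
      (∀ p ∈ convexHull ℝ (AB.1 : Set Plane), affForm α 1 t p < 0) ∧
      ∀ p ∈ convexHull ℝ (AB.2 : Set Plane), 0 < affForm α 1 t p := by
    intro AB
    by_cases h : AB ∈ Q
    · obtain ⟨-, v, -, ⟨hA, hAl, hAh⟩, ⟨hB, hBl, hBh⟩, hlt, -⟩ := Finset.mem_filter.1 h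
      have hAB : AB.1 ≠ AB.2 := by
        intro e
        rw [e] at hlt
        exact lt_irrefl _ hlt
      obtain ⟨l, hl⟩ := exists_separating_line S (hdisj _ hA _ hB hAB)
        (hx _ hA v hAl hAh) (hx _ hB v hBl hBh) hlt
      exact ⟨l, fun _ => hl⟩
    · exact ⟨⊥, fun h' => absurd h' h⟩
  choose sep hsep using hsep
  choose left hleft hleft' using exists_vertical_line_left S
  choose right hright hright' using exists_vertical_line_right S
  -- The cardinalities are at most m + m + 3m.
  let M := P.image (fun A => left (lo A)) ∪ P.image (fun A => right (hi A)) ∪ Q.image sep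
  have hMl : ∀ A ∈ P, left (lo A) ∈ M := fun A hA => Finset.mem_union_left _
    (Finset.mem_union_left _ (Finset.mem_image_of_mem (fun A => left (lo A)) hA))
  have hMr : ∀ A ∈ P, right (hi A) ∈ M := fun A hA => Finset.mem_union_left _
    (Finset.mem_union_right _ (Finset.mem_image_of_mem (fun A => right (hi A)) hA))
  have hMs : ∀ AB ∈ Q, sep AB ∈ M := fun AB hAB => Finset.mem_union_right _
    (Finset.mem_image_of_mem _ hAB)
  refine ⟨M, ?_, ?_, ?_⟩
  · have h1 : M.card ≤ _ := Finset.card_union_le _ _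
    have h2 := Finset.card_union_le (P.image (fun A => left (lo A)))
      (P.image (fun A => right (hi A)))
    have h3 := Finset.card_image_le (s := P) (f := fun A => left (lo A))
    have h4 := Finset.card_image_le (s := P) (f := fun A => right (hi A))
    have h5 := Finset.card_image_le (s := Q) (f := sep)
    omega
  · intro l hl
    rcases Finset.mem_union.1 hl with hl | hl
    · rcases Finset.mem_union.1 hl with hl | hl
      · obtain ⟨A, -, rfl⟩ := Finset.mem_image.1 hl
        exact hleft _
      · obtain ⟨A, -, rfl⟩ := Finset.mem_image.1 hl
        exact hright _
    · obtain ⟨AB, hAB, rfl⟩ := Finset.mem_image.1 hl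
      exact (hsep AB hAB).1
  · have hact : ∀ a ∈ S, ∀ b ∈ S, (¬ ∃ l ∈ M, l.SOppSide a b) → ∀ C ∈ P,
        lo C ≤ a 0 → a 0 ≤ hi C → lo C ≤ b 0 ∧ b 0 ≤ hi C := by
      intro a ha b hb hno C hC h1 h2
      constructor
      · by_contra h3
        exact hno ⟨_, hMl C hC, (hleft' _ b hb a ha (not_le.1 h3) h1).symm⟩
      · by_contra h3
        exact hno ⟨_, hMr C hC, hright' _ a ha b hb h2 (not_le.1 h3)⟩
    have key : ∀ A ∈ P, ∀ B ∈ P, ∀ a ∈ A, ∀ b ∈ B, lo B ≤ a 0 → a 0 ≤ hi B →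
        sliceHeight (a 0) A < sliceHeight (a 0) B → ∃ l ∈ M, l.SOppSide a b := by
      intro A hA B hB a ha b hb hBl hBh hlt
      by_contra hno
      have haS := hsub A hA ha
      have hbS := hsub B hB hb
      obtain ⟨hAl, hAh⟩ := hpt A hA a ha
      obtain ⟨C, hAC, hCB⟩ := exists_directlyAbove hA hAl hAh hB hBl hBh hlt
      have hACQ : (A, C) ∈ Q := Finset.mem_filter.2 ⟨Finset.mem_product.2 ⟨hA, hAC.2.1.1⟩,
        a 0, Finset.mem_image_of_mem _ haS, hAC⟩
      obtain ⟨-, α, t, hf, hfA, hfC⟩ := hsep _ hACQ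
      refine hno ⟨_, hMs _ hACQ, ?_⟩
      rw [sOppSide_iff_affForm hf]
      refine mul_neg_of_neg_of_pos (hfA a (subset_convexHull ℝ _ ha)) ?_
      obtain ⟨-, ⟨hC, hCl, hCh⟩, -, -⟩ := hAC
      rcases hCB.eq_or_lt with e | hCB
      · obtain rfl := hinj _ C hC B hB hCl hCh hBl hBh e
        exact hfC b (subset_convexHull ℝ _ hb)
      · have hne : C ≠ B := by
          rintro rfl
          exact lt_irrefl _ hCB
        -- This line need not lie in `M`. It only shows that `b` is above the point `p` of C's hull
        -- at the abscissa of `b`; since `p` is above the line separating A from C, so is `b`.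
        obtain ⟨l, -, α', t', -, hgC, hgB⟩ := exists_separating_line S (hdisj C hC B hB hne)
          (hx C hC _ hCl hCh) (hx B hB _ hBl hBh) hCB
        obtain ⟨hCl', hCh'⟩ := hact a haS b hbS hno C hC hCl hCh
        obtain ⟨p, hp, hp0, -⟩ := exists_mem_convexHull_sliceHeight (hx C hC _ hCl' hCh')
        have h1 := hgC p hp
        have h2 := hgB b (subset_convexHull ℝ _ hb)
        have h3 := hfC p hp
        rw [affForm, hp0] at h1 h3
        rw [affForm] at h2 ⊢
        linarith
    intro A hA B hB hAB a ha b hb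
    by_contra hno
    have hno' : ¬ ∃ l ∈ M, l.SOppSide b a := by
      rintro ⟨l, hl, h⟩
      exact hno ⟨l, hl, h.symm⟩
    have haS := hsub A hA ha
    have hbS := hsub B hB hb
    obtain ⟨hAl, hAh⟩ := hpt A hA a ha
    obtain ⟨hBl, hBh⟩ := hpt B hB b hb
    obtain ⟨hAl', hAh'⟩ := hact a haS b hbS hno A hA hAl hAh
    obtain ⟨hBl', hBh'⟩ := hact b hbS a haS hno' B hB hBl hBh
    rcases lt_trichotomy (sliceHeight (a 0) A) (sliceHeight (a 0) B) with h | h | h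
    · exact hno (key A hA B hB a ha b hb hBl' hBh' h)
    · exact hAB (hinj _ A hA B hB hAl hAh hBl' hBh' h)
    · exact hno' (key B hB A hA b hb a ha hAl' hAh'
        (hcons _ _ B hB A hA hBl' hBh' hAl hAh hBl hBh hAl' hAh' h))

/-! ### Analysis of the greedy algorithm. -/

section Greedy

variable {k : ℕ} {S : Finset Plane} {c : Plane → Fin k}

open Classical in
/-- The number of ordered pairs of differently coloured points not separated by a line of `L`. -/
noncomputable def unseparated (S : Finset Plane) (c : Plane → Fin k)
    (L : List (AffineSubspace ℝ Plane)) : ℕ :=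
  ((S ×ˢ S).filter fun pq => c pq.1 ≠ c pq.2 ∧ ∀ l ∈ L, ¬ l.SOppSide pq.1 pq.2).card

theorem unseparated_cons_add_gain (L : List (AffineSubspace ℝ Plane))
    (l : AffineSubspace ℝ Plane) :
    unseparated S c (l :: L) + gain S c L l = unseparated S c L := by
  classical
  unfold unseparated gain
  rw [← Finset.card_filter_add_card_filter_not (p := fun pq : Plane × Plane =>
    ¬ l.SOppSide pq.1 pq.2) (s := (S ×ˢ S).filter fun pq => c pq.1 ≠ c pq.2 ∧
      ∀ l ∈ L, ¬ l.SOppSide pq.1 pq.2), Finset.filter_filter, Finset.filter_filter]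
  congr 2
  · ext pq
    simp only [Finset.mem_filter, List.forall_mem_cons]
    tauto
  · ext pq
    simp only [Finset.mem_filter, not_not]
    tauto

theorem unseparated_le_sq (L : List (AffineSubspace ℝ Plane)) :
    unseparated S c L ≤ S.card ^ 2 := by
  classical
  refine (Finset.card_filter_le _ _).trans ?_
  rw [Finset.card_product, sq]

theorem IsLineGreedyRun.isCandidateLine {L : List (AffineSubspace ℝ Plane)}
    (h : IsLineGreedyRun S c L) : ∀ l ∈ L, IsCandidateLine S l := by
  induction h with
  | nil => simp
  | cons l L _ _ hl _ ih => exact List.forall_mem_cons.2 ⟨hl, ih⟩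

theorem separates_iff_unseparated_eq_zero {L : List (AffineSubspace ℝ Plane)}
    (hL : ∀ l ∈ L, IsCandidateLine S l) : Separates S c L ↔ unseparated S c L = 0 := by
  classical
  rw [separates_iff hL, unseparated, Finset.card_eq_zero, Finset.filter_eq_empty_iff]
  constructor
  · rintro h ⟨p, q⟩ hpq ⟨hc, hno⟩
    obtain ⟨l, hl, hopp⟩ := h p (Finset.mem_product.1 hpq).1 q (Finset.mem_product.1 hpq).2 hc
    exact hno l hl hopp
  · intro h p hp q hq hc
    by_contra hno
    push Not at hno
    exact h (x := (p, q)) (Finset.mem_product.2 ⟨hp, hq⟩) ⟨hc, hno⟩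

/-- If `M` separates the colours, then some line of `M` has at least the average gain. -/
theorem unseparated_le_card_mul {M : Finset (AffineSubspace ℝ Plane)}
    (hM : ∀ p ∈ S, ∀ q ∈ S, c p ≠ c q → ∃ l ∈ M, l.SOppSide p q)
    (L : List (AffineSubspace ℝ Plane)) {g : ℕ} (hg : ∀ l ∈ M, gain S c L l ≤ g) :
    unseparated S c L ≤ M.card * g := by
  classical
  refine le_trans ?_ (Finset.card_biUnion_le_card_mul M (fun l => (S ×ˢ S).filter fun pq =>
    c pq.1 ≠ c pq.2 ∧ (∀ l' ∈ L, ¬ l'.SOppSide pq.1 pq.2) ∧ l.SOppSide pq.1 pq.2) g ?_)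
  · refine Finset.card_le_card fun pq hpq => ?_
    obtain ⟨hS, hc, hno⟩ := Finset.mem_filter.1 hpq
    obtain ⟨l, hl, hopp⟩ := hM _ (Finset.mem_product.1 hS).1 _ (Finset.mem_product.1 hS).2 hc
    exact Finset.mem_biUnion.2 ⟨l, hl, Finset.mem_filter.2 ⟨hS, hc, hno, hopp⟩⟩
  · intro l hl
    refine (le_of_eq ?_).trans (hg l hl)
    unfold gain
    congr

variable {M : Finset (AffineSubspace ℝ Plane)}

/-- Greedy reduces the number of unseparated pairs geometrically. -/
theorem IsLineGreedyRun.unseparated_le {K : ℕ} (hK : 0 < K) (hMK : M.card ≤ K)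
    (hMc : ∀ l ∈ M, IsCandidateLine S l)
    (hM : ∀ p ∈ S, ∀ q ∈ S, c p ≠ c q → ∃ l ∈ M, l.SOppSide p q)
    {L : List (AffineSubspace ℝ Plane)} (h : IsLineGreedyRun S c L) :
    (unseparated S c L : ℝ) ≤ (S.card : ℝ) ^ 2 * (1 - 1 / (K : ℝ)) ^ L.length := by
  have hK1 : (1 : ℝ) ≤ K := by exact_mod_cast hK
  have hK' : (0 : ℝ) ≤ 1 - 1 / (K : ℝ) := by
    rw [sub_nonneg, div_le_one (by linarith)]
    exact hK1
  induction h with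
  | nil =>
    have := unseparated_le_sq (S := S) (c := c) []
    simpa using (by exact_mod_cast this : (unseparated S c [] : ℝ) ≤ (S.card : ℝ) ^ 2)
  | cons l L _ _ _ hgreedy ih =>
    -- The greedy gain dominates the gain of every line of `M`, hence their average.
    have h1 := unseparated_le_card_mul hM L (fun l' hl' => hgreedy l' (hMc l' hl'))
    have h2 : unseparated S c L ≤ K * gain S c L l :=
      h1.trans (Nat.mul_le_mul_right _ hMK)
    have h3 : (unseparated S c L : ℝ) ≤ K * gain S c L l := by exact_mod_cast h2
    have h4 : (unseparated S c (l :: L) : ℝ) + gain S c L l = unseparated S c L := by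
      exact_mod_cast unseparated_cons_add_gain L l
    have h5 : (unseparated S c L : ℝ) / K ≤ gain S c L l := by
      rw [div_le_iff₀ (by linarith)]
      linarith
    have h6 : (unseparated S c (l :: L) : ℝ) ≤ unseparated S c L * (1 - 1 / (K : ℝ)) := by
      rw [mul_sub, mul_one, mul_one_div]
      linarith
    refine h6.trans ?_
    rw [List.length_cons, pow_succ (1 - 1 / (K : ℝ)), ← mul_assoc]
    exact mul_le_mul_of_nonneg_right ih hK'

/-- The last line was added while at least one pair remained. The decay bound for the run without it
gives 1 ≤ n² exp(-(ℓ - 1)/K); the summand 1 accounts for that last line. -/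
theorem IsLineGreedyRun.length_le {K : ℕ} (hK : 0 < K) (hMK : M.card ≤ K)
    (hMc : ∀ l ∈ M, IsCandidateLine S l)
    (hM : ∀ p ∈ S, ∀ q ∈ S, c p ≠ c q → ∃ l ∈ M, l.SOppSide p q) (hS : 0 < S.card)
    {L : List (AffineSubspace ℝ Plane)} (h : IsLineGreedyRun S c L) :
    (L.length : ℝ) ≤ 1 + 2 * K * Real.log S.card := by
  have hK1 : (1 : ℝ) ≤ K := by exact_mod_cast hK
  have hS1 : (1 : ℝ) ≤ S.card := by exact_mod_cast hS
  have hlog := Real.log_nonneg hS1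
  cases h with
  | nil =>
    simp only [List.length_nil, Nat.cast_zero]
    positivity
  | cons l L run unfinished _ _ =>
    have h1 := run.unseparated_le hK hMK hMc hM
    rw [separates_iff_unseparated_eq_zero run.isCandidateLine] at unfinished
    have h2 : (1 : ℝ) ≤ unseparated S c L := by exact_mod_cast Nat.one_le_iff_ne_zero.2 unfinished
    have hK' : (0 : ℝ) ≤ 1 - 1 / (K : ℝ) := by
      rw [sub_nonneg, div_le_one (by linarith)]
      exact hK1
    have h3 : (1 - 1 / (K : ℝ)) ^ L.length ≤ Real.exp (-(L.length / K)) := by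
      have : Real.exp (-(L.length / K)) = Real.exp (-(1 / K)) ^ L.length := by
        rw [← Real.exp_nat_mul]
        congr 1
        ring
      rw [this]
      exact pow_le_pow_left₀ hK' (Real.one_sub_le_exp_neg _) _
    have h4 : 1 ≤ (S.card : ℝ) ^ 2 * Real.exp (-(L.length / K)) :=
      h2.trans (h1.trans (mul_le_mul_of_nonneg_left h3 (by positivity)))
    have h5 := Real.log_le_log one_pos h4
    rw [Real.log_one, Real.log_mul (by positivity) (Real.exp_ne_zero _), Real.log_exp,
      Real.log_pow] at h5
    have h6 : (L.length : ℝ) / K ≤ 2 * Real.log S.card := by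
      push_cast at h5
      linarith
    rw [div_le_iff₀ (by linarith)] at h6
    rw [List.length_cons]
    push_cast
    linarith

/-- A run of line-greedy can always be continued to an output. -/
theorem IsLineGreedyRun.exists_output (hMc : ∀ l ∈ M, IsCandidateLine S l)
    (hM : ∀ p ∈ S, ∀ q ∈ S, c p ≠ c q → ∃ l ∈ M, l.SOppSide p q)
    {L : List (AffineSubspace ℝ Plane)} (h : IsLineGreedyRun S c L) :
    ∃ L', IsLineGreedyOutput S c (L' ++ L) := by
  induction hn : unseparated S c L using Nat.strong_induction_on generalizing L with
  | _ n ih =>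
    by_cases hsep : Separates S c L
    · exact ⟨[], h, hsep⟩
    have hpos : unseparated S c L ≠ 0 :=
      fun e => hsep ((separates_iff_unseparated_eq_zero h.isCandidateLine).2 e)
    have hMne : ∃ l ∈ M, 0 < gain S c L l := by
      by_contra hcon
      push Not at hcon
      have := unseparated_le_card_mul hM L (g := 0) hcon
      omega
    obtain ⟨l₀, hl₀, hgain⟩ := hMne
    -- There are infinitely many candidate lines, but their gains are natural numbers bounded by the
    -- number of remaining pairs, so a maximum is attained.
    let G : Set ℕ := {g | ∃ l, IsCandidateLine S l ∧ gain S c L l = g}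
    have hGb : BddAbove G := by
      refine ⟨unseparated S c L, ?_⟩
      rintro _ ⟨l, -, rfl⟩
      have := unseparated_cons_add_gain (S := S) (c := c) L l
      omega
    obtain ⟨l, hl, hlmax⟩ := Nat.sSup_mem (s := G) ⟨_, l₀, hMc l₀ hl₀, rfl⟩ hGb
    have hmax : ∀ l', IsCandidateLine S l' → gain S c L l' ≤ gain S c L l := by
      intro l' hl'
      rw [hlmax]
      exact le_csSup hGb ⟨l', hl', rfl⟩
    have hrun := IsLineGreedyRun.cons l L h hsep hl hmax
    have hdec : unseparated S c (l :: L) < n := by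
      have h1 := unseparated_cons_add_gain (S := S) (c := c) L l
      have h2 := hmax l₀ (hMc l₀ hl₀)
      omega
    obtain ⟨L', hL'⟩ := ih _ hdec hrun rfl
    exact ⟨L' ++ [l], by simpa using hL'⟩

end Greedy

/-! ### The approximation bound. -/

theorem mainTheorem6 :
    ∃ C : ℝ, 0 < C ∧ ∀ (k : ℕ) (S : Finset Plane) (c : Plane → Fin k), 2 ≤ k → 2 ≤ S.card →
      -- line-greedy never gets stuck and always terminates
      (∀ L, IsLineGreedyRun S c L → ∃ L', IsLineGreedyOutput S c (L' ++ L)) ∧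
      (∃ N : ℕ, ∀ L, IsLineGreedyRun S c L → L.length ≤ N) ∧
      -- every output induces an island partition with the claimed approximation ratio
      ∀ L, IsLineGreedyOutput S c L →
        IsIslandPartition S c (inducedParts S L) ∧
        ((inducedParts S L).card : ℝ) ≤
          (C * (optPartition S c : ℝ) * Real.log (S.card : ℝ) ^ 2) * (optPartition S c : ℝ) := by
  -- 169 = 13²: with y = m log n ≥ 0.69 > 2/3, the bound ℓ + 1 ≤ 2 + 10y is at most 13y.
  refine ⟨169, by norm_num, fun k S c _ hn => ?_⟩
  obtain ⟨P, hP, hPcard⟩ := exists_card_eq_optPartition S c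
  have hsub : ∀ A ∈ P, A ⊆ S := by
    intro A hA p hp
    have hp' : p ∈ (A : Set Plane) := hp
    rw [← hP.island A hA] at hp'
    exact hp'.2
  obtain ⟨M, hMcard, hMc, hM⟩ := exists_separating_lines S P hP.nonempty hsub hP.disjoint_hulls
  have hM' : ∀ p ∈ S, ∀ q ∈ S, c p ≠ c q → ∃ l ∈ M, l.SOppSide p q := by
    intro p hp q hq hc
    obtain ⟨A, hA, hpA⟩ := hP.covers p hp
    obtain ⟨B, hB, hqB⟩ := hP.covers q hq
    refine hM A hA B hB ?_ p hpA q hqB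
    rintro rfl
    exact hc (hP.monochromatic A hA p hpA q hqB)
  have hPpos : 0 < P.card := by
    obtain ⟨p, hp⟩ := Finset.card_pos.1 (by omega : 0 < S.card)
    obtain ⟨A, hA, -⟩ := hP.covers p hp
    exact Finset.card_pos.2 ⟨A, hA⟩
  have hlen : ∀ L, IsLineGreedyRun S c L →
      (L.length : ℝ) ≤ 1 + 2 * ((5 * P.card : ℕ) : ℝ) * Real.log S.card :=
    fun L hL => hL.length_le (by omega) hMcard hMc hM' (by omega)
  refine ⟨fun L hL => hL.exists_output hMc hM', ?_, fun L hL => ?_⟩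
  · refine ⟨⌊1 + 2 * ((5 * P.card : ℕ) : ℝ) * Real.log S.card⌋₊, fun L hL => ?_⟩
    exact Nat.le_floor (hlen L hL)
  · refine ⟨isIslandPartition_inducedParts hL.2, ?_⟩
    have h1 : ((inducedParts S L).card : ℝ) ≤ ((L.length : ℝ) + 1) ^ 2 := by
      exact_mod_cast card_inducedParts_le hL.2.1
    have h2 := hlen L hL.1
    rw [← hPcard]
    have hm : (1 : ℝ) ≤ P.card := by exact_mod_cast hPpos
    have hlog : (0.69 : ℝ) ≤ Real.log S.card := by
      have h3 : Real.log 2 ≤ Real.log S.card :=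
        Real.log_le_log (by norm_num) (by exact_mod_cast hn)
      have h4 := Real.log_two_gt_d9
      linarith
    push_cast at h2
    set x := Real.log S.card
    set m : ℝ := (P.card : ℝ)
    have h5 : 0.69 ≤ m * x := by nlinarith
    have h6 : (L.length : ℝ) + 1 ≤ 13 * (m * x) := by nlinarith
    calc ((inducedParts S L).card : ℝ) ≤ ((L.length : ℝ) + 1) ^ 2 := h1
      _ ≤ (13 * (m * x)) ^ 2 := pow_le_pow_left₀ (by positivity) h6 2
      _ = 169 * m * x ^ 2 * m := by ring
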